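/- Let $-\infty\le x_{\min}<x_{\max}\le\infty$, $\Omega=[x_{\min},x_{\max}]\cap\mathbb R$, and let $\mathcal P_2(\Omega)$ be the set of probability measures on $\Omega$ with finite second moment, with the $L^2$-Wasserstein distance $W_2(u,v)=\inf_{\pi\in\Pi(u,v)}\left(\int (x-y)^2\,d\pi(x,y)\right)^{1/2}$. For $u\in\mathcal P_2(\Omega)$ put $\operatorname{cdf}_u(x)=u([x_{\min},x])$ and $\operatorname{icdf}_u(s)=\inf\{x\in\Omega:\operatorname{cdf}_u(x)>s\}$, regarded as an element of $L^2([0,1])$; the map $\operatorname{icdf}$ is injective, and $\mathcal I$ denotes its range. For $w\in\mathcal P_2(\Omega)$ let $\mathcal K_{\operatorname{icdf}_w}=\{f\in L^2([0,1]):\operatorname{icdf}_w+f\in\mathcal I\}$, $\operatorname{Log}_w(u)=\operatorname{icdf}_u-\operatorname{icdf}_w$, and $\operatorname{Exp}_w(f)=\operatorname{icdf}^{-1}(\operatorname{icdf}_w+f)$ for $f\in\mathcal K_{\operatorname{icdf}_w}$. Let $(\mathrm Z,\mu)$ be a probability space of parameters, $u:\mathrm Z\to\mathcal P_2(\Omega)$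 a map, $\mathcal M=u(\mathrm Z)$, $w\in\mathcal P_2(\Omega)$ (for instance the Wasserstein barycenter of the training snapshots), $\mathrm Z_{\rm tr}\subset\mathrm Z$ a finite set with $N$ elements, $\mathcal T=\operatorname{Log}_w(\mathcal M)$ and $\mathcal T_{\rm tr}=\operatorname{Log}_w(u(\mathrm Z_{\rm tr}))$. Let $f_1,\dots,f_N$ be the modes of a PCA of the snapshots $\operatorname{Log}_w(u(z))$, $z\in\mathrm Z_{\rm tr}$: an orthonormal family in $L^2([0,1])$ such that, with $c_k(z)=\langle \operatorname{Log}_w(u(z)),f_k\rangle_{L^2([0,1])}$, one has $\operatorname{Log}_w(u(z))=\sum_{k=1}^N c_k(z)f_k$ for all $z\in\mathrm Z_{\rm tr}$, the functions $c_k$ are pairwise orthogonal in $\ell^2(\mathrm Z_{\rm tr})$, and the singular values $\sigma_k=\|c_k\|_{\ell^2(\mathrm Z_{\rm tr})}=\left(\sum_{z\in\mathrm Z_{\rm tr}}c_k(z)^2\right)^{1/2}$ are non-increasing in $k$. For $n\in\mathbb N$ let $V_n=\operatorname{span}\{f_k:1\le k\le \min(n,N)\}$, let $P_{V_n}$ be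 the orthogonal projection of $L^2([0,1])$ onto $V_n$, and put $f_n^{\rm proj}(z)=P_{V_n}\operatorname{Log}_w(u(z))$ for $z\in\mathrm Z$. Suppose that $\mathcal T_{\rm tr}$ is an $\varepsilon$-covering of $\mathcal T$ (that is, $\mathcal T_{\rm tr}\subseteq\mathcal T$ and $\mathcal T\subseteq\bigcup_{x\in\mathcal T_{\rm tr}}\overline B(x,\varepsilon)$ in $L^2([0,1])$), and that $f_n^{\rm proj}(z)\in\mathcal K_{\operatorname{icdf}_w}$ for all $z\in\mathrm Z$. Let $u_n^{\rm tPCA,proj}(z)=\operatorname{Exp}_w(f_n^{\rm proj}(z))$. Then $$ \left(\int_{\mathrm Z}W_2^2\left(u(z),u_n^{\rm tPCA,proj}(z)\right)d\mu(z)\right)^{1/2}\le\varepsilon+\left(\sum_{k=n+1}^{N}\sigma_k^2\right)^{1/2}. $$ -/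

import Mathlib

open MeasureTheory Set

noncomputable section

namespace TPCA

/-- The domain `Ω = [xmin, xmax] ∩ ℝ`, with `-∞ ≤ xmin` and `xmax ≤ ∞`. -/
def domain (xmin xmax : EReal) : Set ℝ :=
  {x : ℝ | xmin ≤ (x : EReal) ∧ (x : EReal) ≤ xmax}

/-- The set `𝒫₂(Ω)` of probability measures on `Ω` with finite second-order moment.  A measure on
`Ω` is identified with the measure on `ℝ` that it induces, which gives no mass to `ℝ ∖ Ω`. -/
structure P2 (xmin xmax : EReal) where
  measure : Measure ℝ
  isProbabilityMeasure : IsProbabilityMeasure measure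
  measure_compl_domain : measure (domain xmin xmax)ᶜ = 0
  secondMoment_lt_top : ∫⁻ x, ENNReal.ofReal (x ^ 2) ∂measure < ⊤

attribute [instance] P2.isProbabilityMeasure

variable {xmin xmax : EReal}

/-- The set `Π(u,v)` of couplings of `u` and `v`.  (The marginals force such a measure to be a
probability measure that is concentrated on `Ω × Ω`.) -/
def couplings (u v : P2 xmin xmax) : Set (Measure (ℝ × ℝ)) :=
  {π | π.map Prod.fst = u.measure ∧ π.map Prod.snd = v.measure}

/-- The `L²`-Wasserstein distance, with values in `[0,∞]`. -/
def W2 (u v : P2 xmin xmax) : ENNReal :=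
  ⨅ π ∈ couplings u v, (∫⁻ p, ENNReal.ofReal ((p.1 - p.2) ^ 2) ∂π) ^ (1 / 2 : ℝ)

/-- The cumulative distribution function `cdf_u(x) = u([xmin, x])`. -/
def cdf (u : P2 xmin xmax) (x : ℝ) : ℝ := u.measure.real (Iic x)

/-- The generalized inverse `icdf_u(s) = inf {x ∈ Ω | cdf_u(x) > s}` as a function; the values that
matter are those at `0 < s < 1`, where the set is nonempty and bounded below. -/
def icdfFun (u : P2 xmin xmax) (s : ℝ) : ℝ :=
  sInf {x : ℝ | x ∈ domain xmin xmax ∧ s < cdf u x}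

/-- The Hilbert space `L²([0,1])`. -/
abbrev L2I : Type := Lp ℝ 2 ((volume : Measure ℝ).restrict (Icc (0 : ℝ) 1))

lemma cdf_mono (u : P2 xmin xmax) : Monotone (cdf u) := fun _ _ h =>
  measureReal_mono (Iic_subset_Iic.2 h)

lemma cdf_eq (u : P2 xmin xmax) (x : ℝ) : cdf u x = ProbabilityTheory.cdf u.measure x :=
  (ProbabilityTheory.cdf_eq_real u.measure x).symm

lemma exists_mem_domain_le (u : P2 xmin xmax) {s x : ℝ} (hs : 0 ≤ s) (h : s < cdf u x) :
    ∃ t ∈ domain xmin xmax, t ≤ x ∧ s < cdf u t := by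
  by_cases hx : x ∈ domain xmin xmax
  · exact ⟨x, hx, le_rfl, h⟩
  obtain ⟨y, hy⟩ : (domain xmin xmax).Nonempty := by
    by_contra hne
    have h1 := u.measure_compl_domain
    rw [not_nonempty_iff_eq_empty.1 hne, compl_empty, measure_univ] at h1
    exact one_ne_zero h1
  have hpos : 0 < cdf u x := hs.trans_lt h
  by_cases hlo : xmin ≤ (x : EReal)
  · have hhi : xmax < (x : EReal) := not_le.1 fun h' => hx ⟨hlo, h'⟩
    have htop : xmax ≠ ⊤ := ne_top_of_lt hhi
    have hbot : xmax ≠ ⊥ := by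
      rintro rfl
      exact EReal.coe_ne_bot y (le_bot_iff.1 hy.2)
    lift xmax to ℝ using ⟨htop, hbot⟩
    refine ⟨xmax, ⟨hy.1.trans hy.2, le_rfl⟩, (EReal.coe_lt_coe_iff.1 hhi).le, h.trans_le ?_⟩
    have hsub : Iic x ⊆ Iic xmax ∪ (domain xmin (xmax : EReal))ᶜ := by
      intro z _
      by_cases hz : z ≤ xmax
      · exact Or.inl hz
      · exact Or.inr fun hz' => hz (EReal.coe_le_coe_iff.1 hz'.2)
    have h2 : u.measure (Iic x) ≤ u.measure (Iic xmax) :=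
      (measure_mono hsub).trans ((measure_union_le _ _).trans (by
        rw [u.measure_compl_domain, add_zero]))
    exact ENNReal.toReal_mono (measure_ne_top _ _) h2
  · exfalso
    have hsub : Iic x ⊆ (domain xmin xmax)ᶜ := fun z hz hz' =>
      hlo (hz'.1.trans (EReal.coe_le_coe_iff.2 hz))
    have h0 : cdf u x = 0 := by
      simp [cdf, measureReal_def, measure_mono_null hsub u.measure_compl_domain]
    exact hpos.ne' h0

lemma icdfSet_bddBelow (u : P2 xmin xmax) {s : ℝ} (hs : 0 < s) :
    BddBelow {x : ℝ | x ∈ domain xmin xmax ∧ s < cdf u x} := by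
  obtain ⟨a, ha⟩ := ((ProbabilityTheory.tendsto_cdf_atBot u.measure).eventually_lt_const hs).exists
  rw [← cdf_eq] at ha
  exact ⟨a, fun x hx => le_of_not_ge fun hxa => (hx.2.trans_le (cdf_mono u hxa)).not_ge ha.le⟩

lemma icdfSet_nonempty (u : P2 xmin xmax) {s : ℝ} (hs : 0 < s) (hs' : s < 1) :
    {x : ℝ | x ∈ domain xmin xmax ∧ s < cdf u x}.Nonempty := by
  obtain ⟨a, ha⟩ := ((ProbabilityTheory.tendsto_cdf_atTop u.measure).eventually_const_lt hs').exists
  rw [← cdf_eq] at ha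
  obtain ⟨t, ht, -, h⟩ := exists_mem_domain_le u hs.le ha
  exact ⟨t, ht, h⟩

lemma icdfFun_monotoneOn (u : P2 xmin xmax) : MonotoneOn (icdfFun u) (Ioo 0 1) :=
  fun _ ha _ hb hab => csInf_le_csInf (icdfSet_bddBelow u ha.1) (icdfSet_nonempty u hb.1 hb.2)
    fun _ hx => ⟨hx.1, hab.trans_lt hx.2⟩

lemma restrict_Icc_eq :
    (volume : Measure ℝ).restrict (Icc (0 : ℝ) 1) = volume.restrict (Ioo 0 1) :=
  (Measure.restrict_congr_set Ioo_ae_eq_Icc).symm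

lemma icdfFun_aemeasurable (u : P2 xmin xmax) :
    AEMeasurable (icdfFun u) ((volume : Measure ℝ).restrict (Icc (0 : ℝ) 1)) := by
  rw [restrict_Icc_eq]
  exact aemeasurable_restrict_of_monotoneOn measurableSet_Ioo (icdfFun_monotoneOn u)

/-- The law of `icdf_u` under the Lebesgue measure of `[0,1]` is `u`. -/
lemma map_icdfFun (u : P2 xmin xmax) :
    ((volume : Measure ℝ).restrict (Icc (0 : ℝ) 1)).map (icdfFun u) = u.measure := by
  have hm := icdfFun_aemeasurable u
  have : IsProbabilityMeasure ((volume : Measure ℝ).restrict (Icc (0 : ℝ) 1)) :=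
    ⟨by simp⟩
  have := Measure.isProbabilityMeasure_map hm
  refine Measure.ext_of_Iic _ _ fun x => ?_
  rw [Measure.map_apply_of_aemeasurable hm measurableSet_Iic, restrict_Icc_eq,
    Measure.restrict_apply' measurableSet_Ioo]
  have h1 : Ioo 0 (cdf u x) ⊆ icdfFun u ⁻¹' Iic x ∩ Ioo 0 1 := by
    intro s hs
    obtain ⟨t, ht, htx, hst⟩ := exists_mem_domain_le u hs.1.le hs.2
    have hle : cdf u x ≤ 1 := measureReal_le_one
    exact ⟨(csInf_le (icdfSet_bddBelow u hs.1) ⟨ht, hst⟩).trans htx, hs.1, hs.2.trans_le hle⟩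
  have h2 : icdfFun u ⁻¹' Iic x ∩ Ioo 0 1 ⊆ Icc 0 (cdf u x) := by
    rintro s ⟨hsx, hs⟩
    refine ⟨hs.1.le, ?_⟩
    have hy : ∀ y > x, s ≤ cdf u y := by
      intro y hy
      obtain ⟨t, ht, hty⟩ := exists_lt_of_csInf_lt (icdfSet_nonempty u hs.1 hs.2)
        (lt_of_le_of_lt hsx hy)
      exact ht.2.le.trans (cdf_mono u hty.le)
    have hr : Filter.Tendsto (cdf u) (nhdsWithin x (Ioi x)) (nhds (cdf u x)) := by
      have h3 := (ProbabilityTheory.cdf u.measure).right_continuous x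
      have h4 : cdf u = ProbabilityTheory.cdf u.measure := funext (cdf_eq u)
      rw [h4]
      exact h3.tendsto.mono_left (nhdsWithin_mono _ Ioi_subset_Ici_self)
    exact ge_of_tendsto hr (Filter.eventually_of_mem self_mem_nhdsWithin hy)
  have hcdf : ENNReal.ofReal (cdf u x) = u.measure (Iic x) := by
    simp [cdf, measureReal_def]
  refine le_antisymm ((measure_mono h2).trans ?_) (le_trans ?_ (measure_mono h1))
  · rw [Real.volume_Icc, sub_zero, hcdf]
  · rw [Real.volume_Ioo, sub_zero, hcdf]

lemma icdfFun_memLp (u : P2 xmin xmax) :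
    MemLp (icdfFun u) 2 ((volume : Measure ℝ).restrict (Icc (0 : ℝ) 1)) := by
  have hid : MemLp (id : ℝ → ℝ) 2 u.measure := by
    refine ⟨aestronglyMeasurable_id, ?_⟩
    rw [eLpNorm_lt_top_iff_lintegral_rpow_enorm_lt_top (by norm_num) (by norm_num)]
    refine lt_of_eq_of_lt (lintegral_congr fun x => ?_) u.secondMoment_lt_top
    rw [← sq_abs, ENNReal.ofReal_pow (abs_nonneg x), ← Real.norm_eq_abs, ofReal_norm]
    simp
  rw [← map_icdfFun u] at hid
  exact hid.comp_of_map (icdfFun_aemeasurable u)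

/-- The map `icdf : 𝒫₂(Ω) → L²([0,1])`. -/
def icdf (u : P2 xmin xmax) : L2I := (icdfFun_memLp u).toLp (icdfFun u)

lemma icdf_injective : Function.Injective (icdf : P2 xmin xmax → L2I) := by
  intro u v h
  have h1 : icdfFun u =ᵐ[(volume : Measure ℝ).restrict (Icc (0 : ℝ) 1)] icdfFun v :=
    (MemLp.toLp_eq_toLp_iff _ _).1 h
  have h2 : Measure.map (icdfFun u) _ = Measure.map (icdfFun v) _ := Measure.map_congr h1
  rw [map_icdfFun, map_icdfFun] at h2
  cases u
  cases v
  congr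

/-- The set `ℐ = {icdf_u | u ∈ 𝒫₂(Ω)} ⊆ L²([0,1])`. -/
def icdfRange (xmin xmax : EReal) : Set L2I := range (icdf : P2 xmin xmax → L2I)

/-- The inverse `icdf⁻¹ : ℐ → 𝒫₂(Ω)` of the bijection `icdf : 𝒫₂(Ω) → ℐ`. -/
def icdfInv (f : icdfRange xmin xmax) : P2 xmin xmax :=
  (Equiv.ofInjective icdf icdf_injective).symm f

/-- The admissible set `𝒦_{f₀} = {f ∈ L²([0,1]) | f₀ + f ∈ ℐ}`. -/
def admissible (xmin xmax : EReal) (f₀ : L2I) : Set L2I :=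
  {f | f₀ + f ∈ icdfRange xmin xmax}

/-- The exponential map `Exp_w(f) = icdf⁻¹(icdf_w + f)` on `𝒦_{icdf_w}`. -/
def expMap (w : P2 xmin xmax) (f : admissible xmin xmax (icdf w)) : P2 xmin xmax :=
  icdfInv ⟨icdf w + f.1, f.2⟩

/-- The logarithmic map `Log_w(u) = icdf_u - icdf_w`. -/
def logMap (w u : P2 xmin xmax) : L2I := icdf u - icdf w

/-- `C` is an `ε`-covering of `S`: a subset of `S` such that the (closed) balls of radius `ε`
centred in `C` cover `S`. -/
def IsEpsCovering {X : Type*} [PseudoMetricSpace X] (ε : ℝ) (C S : Set X) : Prop :=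
  C ⊆ S ∧ S ⊆ ⋃ x ∈ C, Metric.closedBall x ε

section PCA

variable {Z : Type*}

/-- The coefficient function `c(z) = ⟨Log_w(u(z)), g⟩` of a mode `g`, as an element of
`ℓ²(Z_tr)`. -/
def coeff (w : P2 xmin xmax) (u : Z → P2 xmin xmax) (Ztr : Finset Z) (g : L2I) :
    EuclideanSpace ℝ Ztr :=
  WithLp.toLp 2 fun z => inner ℝ (logMap w (u z)) g

/-- The singular value `σ_k = ‖c_k‖_{ℓ²(Z_tr)}` of the mode `f_k`. -/
def singularValue (w : P2 xmin xmax) (u : Z → P2 xmin xmax) (Ztr : Finset Z)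
    {N : ℕ} (f : Fin N → L2I) (k : Fin N) : ℝ :=
  ‖coeff w u Ztr (f k)‖

/-- `(f_k)` is a PCA of the `N` snapshots `Log_w(u(z))`, `z ∈ Z_tr`: the family `(f_k)` is
orthonormal in `L²([0,1])`, the snapshots are `Log_w(u(z)) = ∑ₖ c_k(z) f_k`, the coefficient
functions `c_k` are pairwise orthogonal in `ℓ²(Z_tr)`, and their norms `σ_k` are non-increasing. -/
structure IsPCA (w : P2 xmin xmax) (u : Z → P2 xmin xmax) (Ztr : Finset Z)
    (f : Fin Ztr.card → L2I) : Prop where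
  orthonormal : Orthonormal ℝ f
  expansion : ∀ z : Ztr, logMap w (u z) = ∑ k, coeff w u Ztr (f k) z • f k
  orthogonal_coeff : Pairwise fun i j =>
    inner ℝ (coeff w u Ztr (f i)) (coeff w u Ztr (f j)) = 0
  antitone_singularValue : Antitone (singularValue w u Ztr f)

/-- `V_n`, the span of the first `n` of the modes (the modes are numbered from `0`). -/
def modeSpace {N : ℕ} (f : Fin N → L2I) (n : ℕ) : Submodule ℝ L2I :=
  Submodule.span ℝ (f '' {k | (k : ℕ) < n})

instance {N : ℕ} (f : Fin N → L2I) (n : ℕ) : FiniteDimensional ℝ (modeSpace f n) :=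
  FiniteDimensional.span_of_finite ℝ (toFinite _)

/-- The projected tangent vector `f_n^proj(z) = P_{V_n} Log_w(u(z))`. -/
def projTangent (w : P2 xmin xmax) (u : Z → P2 xmin xmax) {N : ℕ} (f : Fin N → L2I) (n : ℕ)
    (z : Z) : L2I :=
  (modeSpace f n).starProjection (logMap w (u z))

/-- The reduced approximation `u_n(z)^{tPCA, proj} = Exp_w(f_n^proj(z))`, which is defined when all
the projected tangent vectors are admissible. -/
def tPCAProj (w : P2 xmin xmax) (u : Z → P2 xmin xmax) {N : ℕ} (f : Fin N → L2I) (n : ℕ)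
    (hK : ∀ z, projTangent w u f n z ∈ admissible xmin xmax (icdf w)) (z : Z) : P2 xmin xmax :=
  expMap w ⟨projTangent w u f n z, hK z⟩

/-- The average error `(∫_Z W₂²(u(z), v(z)) dμ(z))^{1/2}`, with values in `[0,∞]`. -/
def avError [MeasurableSpace Z] (μ : Measure Z) (u v : Z → P2 xmin xmax) : ENNReal :=
  (∫⁻ z, W2 (u z) (v z) ^ 2 ∂μ) ^ (1 / 2 : ℝ)

end PCA

end TPCA

end

namespace TPCA

open scoped ENNReal

/-! The error is bounded uniformly in `z`; averaging against a probability measure then costs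
nothing. By the quantile coupling (`W2_le_norm_icdf_sub`) and `icdf_expMap`, the Wasserstein error
at `z` is at most the norm of `(I - P) Log_w(u(z))` in `L²([0,1])`, with `P` the projection onto
`V_n`. Some training snapshot `Log_w(u(t))` lies within `ε` of `Log_w(u(z))`, and `I - P` is a
contraction, so passing from `z` to `t` costs at most `ε`. At `t`, orthonormality of the modes
bounds the squared error by the sum of the discarded `c_k(t)²`, and each `c_k(t)²` is one summand of
`σ_k²`. -/

/-- The pair of quantile functions under Lebesgue measure couples `u` and `v`, so the Wasserstein
distance is at most the `L²`-distance of the quantile functions. -/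
lemma W2_le_norm_icdf_sub {xmin xmax : EReal} (u v : P2 xmin xmax) :
    W2 u v ≤ ENNReal.ofReal ‖icdf u - icdf v‖ := by
  have hu := icdfFun_aemeasurable u
  have hv := icdfFun_aemeasurable v
  have hcouple : ((volume : Measure ℝ).restrict (Icc (0 : ℝ) 1)).map
      (fun s => (icdfFun u s, icdfFun v s)) ∈ couplings u v := by
    refine ⟨?_, ?_⟩
    · rw [AEMeasurable.map_map_of_aemeasurable measurable_fst.aemeasurable (hu.prodMk hv)]
      exact map_icdfFun u
    · rw [AEMeasurable.map_map_of_aemeasurable measurable_snd.aemeasurable (hu.prodMk hv)]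
      exact map_icdfFun v
  refine (iInf₂_le _ hcouple).trans (le_of_eq ?_)
  rw [lintegral_map' (by fun_prop) (hu.prodMk hv), ofReal_norm, icdf, icdf, ← MemLp.toLp_sub,
    Lp.enorm_toLp, eLpNorm_eq_lintegral_rpow_enorm_toReal two_ne_zero ENNReal.ofNat_ne_top]
  simp only [ENNReal.toReal_ofNat]
  congr 1
  refine lintegral_congr fun s => ?_
  rw [← sq_abs, ENNReal.ofReal_pow (abs_nonneg _), ← Real.norm_eq_abs, ofReal_norm]
  simp

/-- In quantile coordinates the exponential map is a translation, so errors after `Exp_w` can be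
measured in the tangent space. -/
lemma icdf_expMap {xmin xmax : EReal} (w : P2 xmin xmax) (g : admissible xmin xmax (icdf w)) :
    icdf (expMap w g) = icdf w + g.1 :=
  congrArg Subtype.val
    ((Equiv.ofInjective icdf icdf_injective).apply_symm_apply ⟨icdf w + g.1, g.2⟩)

variable {xmin xmax : EReal} {Z : Type*}

/-- The projection error of a snapshot is controlled by the discarded singular values. -/
lemma norm_logMap_sub_projTangent_le_of_mem {w : P2 xmin xmax} {u : Z → P2 xmin xmax}
    {Ztr : Finset Z} {f : Fin Ztr.card → L2I} (hf : IsPCA w u Ztr f) (n : ℕ) (z : Ztr) :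
    ‖logMap w (u z) - projTangent w u f n z‖ ≤
      √(∑ k ∈ Finset.univ.filter (fun k : Fin Ztr.card => n ≤ (k : ℕ)),
        singularValue w u Ztr f k ^ 2) := by
  set c : Fin Ztr.card → ℝ := fun k => coeff w u Ztr (f k) z
  -- The truncated expansion serves as a competitor in `V_n`. Modes are numbered from `0`, so the
  -- discarded ones are those with `n ≤ k`; there are none once `n` reaches the number of snapshots.
  have hmem : ∑ k ∈ Finset.univ.filter (fun k : Fin Ztr.card => ¬ n ≤ (k : ℕ)), c k • f k ∈
      modeSpace f n :=
    Submodule.sum_mem _ fun k hk => Submodule.smul_mem _ _ <| Submodule.subset_span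
      ⟨k, not_le.1 (Finset.mem_filter.1 hk).2, rfl⟩
  have hdiff : logMap w (u z) -
      ∑ k ∈ Finset.univ.filter (fun k : Fin Ztr.card => ¬ n ≤ (k : ℕ)), c k • f k =
      ∑ k ∈ Finset.univ.filter (fun k : Fin Ztr.card => n ≤ (k : ℕ)), c k • f k := by
    rw [sub_eq_iff_eq_add, Finset.sum_filter_add_sum_filter_not]
    exact hf.expansion z
  have hmin : ‖logMap w (u z) - projTangent w u f n z‖ ≤ ‖logMap w (u z) -
      ∑ k ∈ Finset.univ.filter (fun k : Fin Ztr.card => ¬ n ≤ (k : ℕ)), c k • f k‖ := by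
    rw [projTangent, Submodule.starProjection_minimal]
    -- The projection error is the infimum of the distances to points of `V_n`; `0` is a lower bound
    -- for these distances.
    exact ciInf_le ⟨0, by rintro _ ⟨y, rfl⟩; positivity⟩ (⟨_, hmem⟩ : modeSpace f n)
  refine hmin.trans (Real.le_sqrt_of_sq_le ?_)
  rw [hdiff, ← real_inner_self_eq_norm_sq, hf.orthonormal.inner_sum]
  -- After Pythagoras, compare termwise: one coordinate of `c_k` is at most its `ℓ²` norm `σ_k`.
  refine Finset.sum_le_sum fun k _ => ?_
  have hc : ‖c k‖ ≤ singularValue w u Ztr f k := PiLp.norm_apply_le (coeff w u Ztr (f k)) z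
  simpa [sq] using pow_le_pow_left₀ (norm_nonneg _) hc 2

/-- The projection error on the whole tangent set, given an `ε`-covering by the snapshots. -/
lemma norm_logMap_sub_projTangent_le {w : P2 xmin xmax} {u : Z → P2 xmin xmax}
    {Ztr : Finset Z} {f : Fin Ztr.card → L2I} (hf : IsPCA w u Ztr f) (n : ℕ) {ε : ℝ}
    (hcov : IsEpsCovering ε (logMap w '' (u '' (Ztr : Set Z))) (logMap w '' range u)) (z : Z) :
    ‖logMap w (u z) - projTangent w u f n z‖ ≤
      ε + √(∑ k ∈ Finset.univ.filter (fun k : Fin Ztr.card => n ≤ (k : ℕ)),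
        singularValue w u Ztr f k ^ 2) := by
  obtain ⟨_, ⟨_, ⟨t, ht, rfl⟩, rfl⟩, hball⟩ := mem_iUnion₂.1 (hcov.2 ⟨u z, ⟨z, rfl⟩, rfl⟩)
  rw [Metric.mem_closedBall, dist_eq_norm] at hball
  -- `I - P` is the projection onto the orthogonal complement of `V_n`, hence linear and of norm at
  -- most one.
  have hsplit : logMap w (u z) - projTangent w u f n z =
      (modeSpace f n)ᗮ.starProjection (logMap w (u z) - logMap w (u t)) +
        (logMap w (u t) - projTangent w u f n t) := by
    rw [Submodule.starProjection_orthogonal_val, map_sub, projTangent, projTangent]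
    abel
  rw [hsplit]
  exact (norm_add_le _ _).trans <| add_le_add
    ((Submodule.norm_starProjection_apply_le _ _).trans hball)
    (norm_logMap_sub_projTangent_le_of_mem hf n ⟨t, ht⟩)

/-- Total mass one makes the average of a constant equal to that constant. Monotonicity of the lower
integral requires no measurability of the error in `z`. -/
lemma avError_le_of_forall_le [MeasurableSpace Z] (μ : Measure Z) [IsProbabilityMeasure μ]
    {u v : Z → P2 xmin xmax} {C : ℝ≥0∞} (h : ∀ z, W2 (u z) (v z) ≤ C) : avError μ u v ≤ C := by
  calc avError μ u v ≤ (∫⁻ _, C ^ 2 ∂μ) ^ (1 / 2 : ℝ) :=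
        ENNReal.rpow_le_rpow (lintegral_mono fun z => pow_le_pow_left' (h z) 2) (by norm_num)
    _ = C := by
        rw [lintegral_const, measure_univ, mul_one, ← ENNReal.rpow_natCast, ← ENNReal.rpow_mul]
        norm_num

end TPCA

theorem mainTheorem3 {xmin xmax : EReal} (hΩ : xmin < xmax)
    {Z : Type*} [MeasurableSpace Z] (μ : MeasureTheory.Measure Z)
    [MeasureTheory.IsProbabilityMeasure μ]
    (u : Z → TPCA.P2 xmin xmax) (w : TPCA.P2 xmin xmax) (Ztr : Finset Z)
    (f : Fin Ztr.card → TPCA.L2I) (hf : TPCA.IsPCA w u Ztr f) (n : ℕ) (ε : ℝ)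
    (hcov : TPCA.IsEpsCovering ε
      (TPCA.logMap w '' (u '' (Ztr : Set Z))) (TPCA.logMap w '' Set.range u))
    (hK : ∀ z, TPCA.projTangent w u f n z ∈ TPCA.admissible xmin xmax (TPCA.icdf w)) :
    TPCA.avError μ u (TPCA.tPCAProj w u f n hK) ≤
      ENNReal.ofReal (ε + √(∑ k ∈ Finset.univ.filter (fun k : Fin Ztr.card => n ≤ (k : ℕ)),
        TPCA.singularValue w u Ztr f k ^ 2)) := by
  refine TPCA.avError_le_of_forall_le μ fun z => (TPCA.W2_le_norm_icdf_sub _ _).trans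
    (ENNReal.ofReal_le_ofReal ?_)
  have h := TPCA.norm_logMap_sub_projTangent_le hf n hcov z
  -- Regrouping attaches `icdf w` to the projected tangent vector, and their sum is the quantile
  -- function of the reduced approximation.
  rwa [TPCA.logMap, sub_sub, ← TPCA.icdf_expMap w ⟨_, hK z⟩] at h
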